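/- Let $n\ge 1$. The \emph{relativised least number principle} $\mathrm{RLNP}_n$ is the following set of clauses in the propositional variables $R_i$, $L_{i,j}$, $S_{i,j}$ ($i,j\in[n]=\{1,\dots,n\}$): \[ \begin{array}{ll} \neg R_i \vee \neg L_{i,i} & i\in[n],\\ \neg R_i \vee \neg R_j \vee \neg R_l \vee \neg L_{i,j} \vee \neg L_{j,l} \vee L_{i,l} & i,j,l\in[n],\\ \bigvee_{i\in[n]} S_{i,j} & j\in[n],\\ \neg S_{i,j}\vee\neg R_j\vee R_i & i,j\in[n],\\ \neg S_{i,j}\vee\neg R_j\vee L_{i,j} & i,j\in[n],\\ R_n. & \end{array} \] For $k\in\mathbb{N}$, a \emph{p-Res(1) refutation} (parameterized Resolution refutation) of $(\mathrm{RLNP}_n,k)$ is a Resolution refutation of the set of clauses consisting of $\mathrm{RLNP}_n$ and all clauses $\neg v_1\vee\dots\vee\neg v_{k+1}$, where $v_1,\dots,v_{k+1}$ are distinct variables of $\mathrm{RLNP}_n$. That is, it is a directed acyclic graph whose nodes are labelled by clauses, each of which is one of these initial clauses or follows from the labels of its predecessors by the resolution rule (from $P\vee x$ and $Q\vee\neg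 x$ derive $P\vee Q$) or by weakening (adding literals), and in which the empty clause occurs. Its \emph{size} is the number of its nodes. \textbf{Theorem.} For every $k\in\mathbb{N}$ there is an $N$ such that for all $n\ge N$, every p-Res(1) refutation of $(\mathrm{RLNP}_n,k)$ has size at least $n^{\sqrt{k/4}}$. -/

import Mathlib

/-- A literal over the propositional variables `V`. -/
inductive Literal (V : Type) : Type where
  | pos (v : V) : Literal V
  | neg (v : V) : Literal V
  deriving DecidableEq

/-- A clause: a finite disjunction of literals, up to order and repetition.
`∅` is the empty clause. -/
abbrev Clause (V : Type) : Type := Finset (Literal V)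

/-- `E` follows from `C = P ∨ x` and `D = Q ∨ ¬x` by the resolution rule: `E = P ∨ Q`. -/
def IsResolvent {V : Type} [DecidableEq V] (C D E : Clause V) : Prop :=
  ∃ (x : V) (P Q : Clause V),
    C = insert (Literal.pos x) P ∧ D = insert (Literal.neg x) Q ∧ E = P ∪ Q

/-- A Resolution refutation of the set of clauses `F`, given as a DAG whose nodes
`0, …, size - 1` are listed in topological order. Each node is labelled by a clause that is an
initial clause, a weakening of the label of an earlier node, or a resolvent of the labels of two
earlier nodes; some node is labelled by the empty clause. `size` is the number of nodes.
One weakening step may add several literals, and nodes that are not used later are not forbidden;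
both conventions only make more refutations available at a given size. -/
structure ResolutionRefutation {V : Type} [DecidableEq V] (F : Set (Clause V)) where
  size : ℕ
  label : Fin size → Clause V
  derived : ∀ i, label i ∈ F ∨
    (∃ a, a < i ∧ label a ⊆ label i) ∨
    (∃ a b, a < i ∧ b < i ∧ IsResolvent (label a) (label b) (label i))
  refutes : ∃ i, label i = ∅

/-- The parameterized clauses: all `¬v₁ ∨ … ∨ ¬vₖ₊₁` with `k + 1` distinct variables. -/
def parameterizedClauses (V : Type) [DecidableEq V] (k : ℕ) : Set (Clause V) :=
  {C | ∃ T : Finset V, T.card = k + 1 ∧ C = T.image Literal.neg}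

/-- A p-Res(1) (parameterized Resolution) refutation of `(F, k)`: a Resolution refutation of `F`
together with all the parameterized clauses. Its size counts only clauses appearing in it. -/
abbrev PResRefutation {V : Type} [DecidableEq V] (F : Set (Clause V)) (k : ℕ) : Type :=
  ResolutionRefutation (F ∪ parameterizedClauses V k)

/-- The variables `R_i`, `L_{i,j}`, `S_{i,j}` of the relativised least number principle. -/
inductive RLNPVar (n : ℕ) : Type where
  | R (i : Fin n) : RLNPVar n
  | L (i j : Fin n) : RLNPVar n
  | S (i j : Fin n) : RLNPVar n
  deriving DecidableEq

open Literal RLNPVar in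
/-- The clauses of the relativised least number principle on the elements `[n]` (here `Fin n`, so
that the last element is the one of value `n - 1`): `L` is a strict partial order on the
elements satisfying `R`, every such element has (named by `S`) a smaller one, and the last
element satisfies `R`. -/
def RLNP (n : ℕ) : Set (Clause (RLNPVar n)) :=
  {C | (∃ i, C = {neg (R i), neg (L i i)}) ∨
    (∃ i j l, C = {neg (R i), neg (R j), neg (R l), neg (L i j), neg (L j l), pos (L i l)}) ∨
    (∃ j, C = Finset.univ.image (fun i => pos (S i j))) ∨
    (∃ i j, C = {neg (S i j), neg (R j), pos (R i)}) ∨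
    (∃ i j, C = {neg (S i j), neg (R j), pos (L i j)}) ∨
    (∃ i : Fin n, (i : ℕ) + 1 = n ∧ C = {pos (R i)})}

/-!
# Size lower bound for parameterized Resolution refutations of the relativised least number principle

For `1 ≤ k ≤ 4` the bound is at most `n`, and `lt_size_of_pos` gives more than `n` nodes. For `k ≥ 5`
the proof plays an adversary against the refutation after a random restriction.

Let `n` be about `t ^ 20`. Split (most of) the elements into `t ^ 6` blocks of size `t ^ 14`, keep one
random element of each block and the last element, and set `R` to false elsewhere. Each `L i j`
with a discarded index and each `S i j` with `j` discarded is set to true with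
probability `t ^ (-5)`, independently. On the kept elements, where `R` is true, an adversary answers
according to a finite order with witnesses. While few kept elements are in the scope of the current
clause, one of the other kept elements can be moved below everything and serve as a new witness
(`Position.exists_extension`), so the adversary reaches an initial clause
(`ResolutionRefutation.exists_initial_position`), which is not one of `RLNP n`
(`Position.notMem_RLNP`).

The clauses met by the adversary do have a small scope, unless a clause with many preset variables
survives or a set of size `O(t ^ 6)` has many selected elements. A parameterized
clause can only be falsified at a price (`Position.exists_cost`): `m` kept elements give at
most `m + (m - 1) + m (m - 1) / 2` true variables, because `L` is antisymmetric and the witnesses are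
unique, and all other true variables are random bits. With `r = m - 1` selected elements
and `b` bits the probability is about `t ^ (-(14 r + 5 b))`, and `k + 1` true variables
force `(14 r + 5 b) ^ 2 > 100 k` (`hundred_mul_lt_sq`). Since one of these bad events occurs at some
clause whatever the restriction (`exists_bad_event`), the union bound (`one_le_size_mul`) gives a size
of at least a constant times `t ^ W` with the integer `W = ⌊√(100 k)⌋ + 1`, and this exceeds
`n ^ √(k / 4)`, which is about `t ^ √(100 k)`.
-/

open Finset

/-! ### Clauses, falsification and resolution steps -/

namespace Literal

variable {V : Type}

/-- The variable of a literal. -/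
def var : Literal V → V
  | pos v => v
  | neg v => v

/-- The literal is false under the total assignment `α`. -/
def Falsified (α : V → Prop) : Literal V → Prop
  | pos v => ¬ α v
  | neg v => α v

end Literal

/-- The set of variables that occur in a clause. -/
def clauseVars {V : Type} [DecidableEq V] (C : Clause V) : Finset V := C.image Literal.var

/-- The total assignment `α` makes every literal of the clause false. -/
def Falsifies {V : Type} (α : V → Prop) (C : Clause V) : Prop := ∀ l ∈ C, l.Falsified α

theorem Falsifies.mono {V : Type} {α : V → Prop} {C D : Clause V} (h : Falsifies α D)
    (hCD : C ⊆ D) : Falsifies α C := fun l hl => h l (hCD hl)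

/-- An assignment that falsifies a resolvent falsifies one of the two premises, and that premise
has at most one literal outside the resolvent. The pivot `x` does not depend on the assignment,
so an adversary may still choose the value of `x`. -/
theorem IsResolvent.exists_falsified_premise {V : Type} [DecidableEq V] {C D E : Clause V}
    (h : IsResolvent C D E) :
    ∃ x : V, ∀ α, Falsifies α E →
      ∃ G, (G = C ∨ G = D) ∧ Falsifies α G ∧ ∃ l : Literal V, l.var = x ∧ G ⊆ insert l E := by
  obtain ⟨x, P, Q, rfl, rfl, rfl⟩ := h
  refine ⟨x, fun α hα => ?_⟩
  by_cases hx : α x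
  · refine ⟨_, Or.inr rfl, ?_, Literal.neg x, rfl,
      insert_subset_insert _ subset_union_right⟩
    intro l hl
    rcases mem_insert.1 hl with rfl | hl
    · exact hx
    · exact hα l (mem_union_right _ hl)
  · refine ⟨_, Or.inl rfl, ?_, Literal.pos x, rfl,
      insert_subset_insert _ subset_union_left⟩
    intro l hl
    rcases mem_insert.1 hl with rfl | hl
    · exact hx
    · exact hα l (mem_union_left _ hl)

/-! ### A linear lower bound -/

/-- For `k ≥ 1` every refutation has more than `n` nodes. Consider the assignment in which only `R` of the last
element holds. The initial clauses that it falsifies have `n` literals, and a resolution step along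
its falsified path removes one literal at a time. -/
theorem lt_size_of_pos {n k : ℕ} (hk : 1 ≤ k) (ρ : PResRefutation (RLNP n) k) : n < ρ.size := by
  classical
  set α : RLNPVar n → Prop := fun v => ∃ i : Fin n, (i : ℕ) + 1 = n ∧ v = RLNPVar.R i with hα
  have hL : ∀ i j, ¬ α (RLNPVar.L i j) := by rintro i j ⟨_, _, h⟩; cases h
  have hS : ∀ i j, ¬ α (RLNPVar.S i j) := by rintro i j ⟨_, _, h⟩; cases h
  have key : ∀ m : ℕ, ∀ i : Fin ρ.size, (i : ℕ) = m → Falsifies α (ρ.label i) →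
      n ≤ (ρ.label i).card + i := by
    intro m
    induction m using Nat.strong_induction_on with
    | _ m ih =>
    rintro i rfl hf
    rcases ρ.derived i with (hF | hF) | ⟨a, ha, hsub⟩ | ⟨a, b, ha, hb, hres⟩
    · rcases hF with ⟨a, h⟩ | ⟨a, b, c, h⟩ | ⟨j, h⟩ | ⟨a, b, h⟩ | ⟨a, b, h⟩ | ⟨a, ha, h⟩ <;>
        rw [h] at hf
      · exact absurd (hf (.neg (.L a a)) (by simp)) (hL a a)
      · exact absurd (hf (.neg (.L a b)) (by simp)) (hL a b)
      · rw [h, card_image_of_injective _ (fun a b h => by cases h; rfl)]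
        simp
      · exact absurd (hf (.neg (.S a b)) (by simp)) (hS a b)
      · exact absurd (hf (.neg (.S a b)) (by simp)) (hS a b)
      · exact absurd ⟨a, ha, rfl⟩ (hf (.pos (.R a)) (by simp))
    · obtain ⟨T, hT, h⟩ := hF
      rw [h] at hf
      obtain ⟨u, hu, v, hv, huv⟩ := one_lt_card.1 (by omega : 1 < T.card)
      obtain ⟨i, hi, rfl⟩ := hf (.neg u) (mem_image_of_mem _ hu)
      obtain ⟨j, hj, rfl⟩ := hf (.neg v) (mem_image_of_mem _ hv)
      exact absurd (congrArg RLNPVar.R (Fin.ext (by omega))) huv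
    · have := ih a ha a rfl (hf.mono hsub)
      have := card_le_card hsub
      have : (a : ℕ) < i := ha
      omega
    · obtain ⟨x, hx⟩ := hres.exists_falsified_premise
      obtain ⟨G, hG, hGf, l, -, hl⟩ := hx α hf
      obtain ⟨c, hc, rfl⟩ : ∃ c, c < i ∧ ρ.label c = G := by
        rcases hG with rfl | rfl
        exacts [⟨a, ha, rfl⟩, ⟨b, hb, rfl⟩]
      have := ih c hc c rfl hGf
      have := (card_le_card hl).trans (card_insert_le _ _)
      have : (c : ℕ) < i := hc
      omega
  obtain ⟨i, hi⟩ := ρ.refutes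
  have := key i i rfl (by rw [hi]; intro l hl; simp at hl)
  rw [hi] at this
  have := i.2
  simp at *
  omega

/-! ### The adversary on a set of kept elements -/

namespace RLNPVar

variable {n : ℕ}

/-- All elements named by a variable. -/
def elements : RLNPVar n → Finset (Fin n)
  | R i => {i}
  | L i j => {i, j}
  | S i j => {i, j}

/-- The elements whose place in the order, or whose witness, the variable asks about. The first
index of `S i j` is left out: the clause `⋁ i, S i j` is about the witness of the single
element `j`. -/
def scope : RLNPVar n → Finset (Fin n)
  | R _ => ∅
  | L i j => {i, j}
  | S _ j => {j}

/-- The variables that are set independently of the adversary when the elements of `K` are kept. -/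
def Preset (K : Finset (Fin n)) : RLNPVar n → Prop
  | R _ => False
  | L i j => ¬ (i ∈ K ∧ j ∈ K)
  | S _ j => j ∉ K

/-- The assignment in which `R` holds exactly on `K`, the elements of `K` are ordered
by `depth` (deeper is smaller), `f j` is the only witness for `j ∈ K`, and the bits `β` supply all
remaining values. -/
def assignment (K : Finset (Fin n)) (β : RLNPVar n → Prop) (depth : Fin n → ℕ)
    (f : Fin n → Fin n) : RLNPVar n → Prop
  | R i => i ∈ K
  | L i j => (i ∈ K ∧ j ∈ K ∧ depth j < depth i) ∨ (¬ (i ∈ K ∧ j ∈ K) ∧ β (L i j))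
  | S i j => (j ∈ K ∧ f j = i) ∨ (j ∉ K ∧ β (S i j))

theorem assignment_of_preset {K : Finset (Fin n)} {β : RLNPVar n → Prop} {depth : Fin n → ℕ}
    {f : Fin n → Fin n} {v : RLNPVar n} (hv : v.Preset K) :
    assignment K β depth f v ↔ β v := by
  cases v <;> simp only [Preset, assignment] at * <;> tauto

end RLNPVar

/-- The union of the scopes of the variables of a clause. -/
def clauseScope {n : ℕ} (C : Clause (RLNPVar n)) : Finset (Fin n) :=
  (clauseVars C).biUnion RLNPVar.scope

theorem mem_clauseScope {n : ℕ} {C : Clause (RLNPVar n)} {l : Literal (RLNPVar n)} (hl : l ∈ C)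
    {i : Fin n} (hi : i ∈ l.var.scope) : i ∈ clauseScope C :=
  mem_biUnion.2 ⟨_, mem_image_of_mem _ hl, hi⟩

theorem clauseScope_mono {n : ℕ} {C D : Clause (RLNPVar n)} (h : C ⊆ D) :
    clauseScope C ⊆ clauseScope D :=
  biUnion_subset_biUnion_of_subset_left _ (image_subset_image h)

theorem clauseScope_insert {n : ℕ} (C : Clause (RLNPVar n)) (l : Literal (RLNPVar n)) :
    clauseScope (insert l C) = l.var.scope ∪ clauseScope C := by
  simp [clauseScope, clauseVars, image_insert, biUnion_insert]

/-- The adversary's choice of an order and of witnesses for the kept elements is sound for the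
clause `C`: it stays inside `K`, the witnesses of the elements in the scope of `C` are smaller
than these, and `C` is falsified. -/
structure Position {n : ℕ} (K : Finset (Fin n)) (β : RLNPVar n → Prop) (C : Clause (RLNPVar n))
    (depth : Fin n → ℕ) (f : Fin n → Fin n) : Prop where
  mapsTo : ∀ j ∈ K, f j ∈ K
  lt_witness : ∀ j ∈ clauseScope C, j ∈ K → depth j < depth (f j)
  falsifies : Falsifies (RLNPVar.assignment K β depth f) C

theorem Position.mono {n : ℕ} {K : Finset (Fin n)} {β : RLNPVar n → Prop}
    {C D : Clause (RLNPVar n)} {depth : Fin n → ℕ} {f : Fin n → Fin n}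
    (h : Position K β D depth f) (hCD : C ⊆ D) : Position K β C depth f :=
  ⟨h.mapsTo, fun j hj => h.lt_witness j (clauseScope_mono hCD hj), h.falsifies.mono hCD⟩

/-- If few kept elements are in the scope of `C`, the adversary can extend the scope by any variable
`x`: some kept element `z` is neither in the scope nor a witness for it, and moving `z` below
everything makes it a witness for all elements outside the scope. -/
theorem Position.exists_extension {n : ℕ} {K : Finset (Fin n)} {β : RLNPVar n → Prop}
    {C : Clause (RLNPVar n)} {depth : Fin n → ℕ} {f : Fin n → Fin n}
    (h : Position K β C depth f) (hcard : 2 * #(clauseScope C ∩ K) + 2 < #K) (x : RLNPVar n) :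
    ∃ depth' f', Position K β C depth' f' ∧
      ∀ j ∈ x.scope, j ∈ K → depth' j < depth' (f' j) := by
  classical
  have hx : #x.scope ≤ 2 := by
    cases x <;> simp [RLNPVar.scope, card_le_two]
  obtain ⟨z, hzK, hz⟩ : ∃ z ∈ K,
      z ∉ (clauseScope C ∩ K) ∪ (clauseScope C ∩ K).image f ∪ x.scope := by
    apply exists_mem_notMem_of_card_lt_card
    have h1 := card_union_le ((clauseScope C ∩ K) ∪ (clauseScope C ∩ K).image f) x.scope
    have h2 := card_union_le (clauseScope C ∩ K) ((clauseScope C ∩ K).image f)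
    have h3 := card_image_le (s := clauseScope C ∩ K) (f := f)
    omega
  simp only [mem_union, mem_inter, mem_image, not_or, not_exists, not_and] at hz
  obtain ⟨⟨hzC, hzf⟩, hzx⟩ := hz
  have hzC' : z ∉ clauseScope C := fun h => hzC h hzK
  have hlt : ∀ j, depth j < univ.sup depth + 1 := fun j =>
    Nat.lt_succ_of_le (le_sup (mem_univ j))
  refine ⟨Function.update depth z (univ.sup depth + 1),
    fun j => if j ∈ clauseScope C then f j else z, ⟨?_, ?_, ?_⟩, ?_⟩
  · intro j hj
    split_ifs
    exacts [h.mapsTo j hj, hzK]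
  · intro j hj hjK
    have hjz : j ≠ z := fun e => hzC' (e ▸ hj)
    simp only [hj, if_true]
    rw [Function.update_of_ne hjz, Function.update_of_ne (hzf j ⟨hj, hjK⟩)]
    exact h.lt_witness j hj hjK
  · intro l hl
    have hsc : ∀ i ∈ l.var.scope, i ∈ clauseScope C := fun i hi => mem_clauseScope hl hi
    have heq : RLNPVar.assignment K β (Function.update depth z (univ.sup depth + 1))
        (fun j => if j ∈ clauseScope C then f j else z) l.var ↔
        RLNPVar.assignment K β depth f l.var := by
      generalize l.var = v at hsc
      cases v with
      | R i => rfl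
      | L i j =>
        have hi : i ≠ z := fun e => hzC' (e ▸ hsc i (by simp [RLNPVar.scope]))
        have hj : j ≠ z := fun e => hzC' (e ▸ hsc j (by simp [RLNPVar.scope]))
        simp [RLNPVar.assignment, Function.update_of_ne hi, Function.update_of_ne hj]
      | S i j =>
        have hj := hsc j (by simp [RLNPVar.scope])
        simp [RLNPVar.assignment, hj]
    have := h.falsifies l hl
    cases l with
    | pos v => exact fun hc => this (heq.1 hc)
    | neg v => exact heq.2 this
  · intro j hj hjK
    have hjz : j ≠ z := fun e => hzx (e ▸ hj)
    by_cases hjC : j ∈ clauseScope C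
    · simp only [hjC, if_true]
      rw [Function.update_of_ne hjz, Function.update_of_ne (hzf j ⟨hjC, hjK⟩)]
      exact h.lt_witness j hjC hjK
    · simp only [hjC, if_false, Function.update_self]
      rw [Function.update_of_ne hjz]
      exact hlt j

/-- A sound position never falsifies a clause of `RLNP n`, unless the preset bits alone already
falsify the clause `⋁ i, S i j` of some discarded element `j`. -/
theorem Position.notMem_RLNP {n : ℕ} {K : Finset (Fin n)} {β : RLNPVar n → Prop}
    {C : Clause (RLNPVar n)} {depth : Fin n → ℕ} {f : Fin n → Fin n}
    (h : Position K β C depth f) (hlast : ∀ i : Fin n, (i : ℕ) + 1 = n → i ∈ K)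
    (hS : ∀ j ∉ K, C = univ.image (fun i => Literal.pos (RLNPVar.S i j)) →
      ∃ i, β (RLNPVar.S i j)) : C ∉ RLNP n := by
  have hf := h.falsifies
  rintro (⟨a, rfl⟩ | ⟨a, b, c, rfl⟩ | ⟨j, rfl⟩ | ⟨a, b, rfl⟩ | ⟨a, b, rfl⟩ | ⟨a, ha, rfl⟩)
  · have h1 := hf (.neg (.R a)) (by simp)
    have h2 := hf (.neg (.L a a)) (by simp)
    simp only [Literal.Falsified, RLNPVar.assignment] at h1 h2
    simp [h1] at h2
  · have h1 := hf (.neg (.R a)) (by simp)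
    have h2 := hf (.neg (.R b)) (by simp)
    have h3 := hf (.neg (.R c)) (by simp)
    have h4 := hf (.neg (.L a b)) (by simp)
    have h5 := hf (.neg (.L b c)) (by simp)
    have h6 := hf (.pos (.L a c)) (by simp)
    simp only [Literal.Falsified, RLNPVar.assignment] at h1 h2 h3 h4 h5 h6
    simp [h1, h2, h3] at h4 h5 h6
    omega
  · by_cases hj : j ∈ K
    · have := hf (.pos (.S (f j) j)) (by simp)
      simp [Literal.Falsified, RLNPVar.assignment, hj] at this
    · obtain ⟨i, hi⟩ := hS j hj rfl
      have := hf (.pos (.S i j)) (by simp)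
      simp [Literal.Falsified, RLNPVar.assignment, hj, hi] at this
  · have h1 := hf (.neg (.S a b)) (by simp)
    have h2 := hf (.neg (.R b)) (by simp)
    have h3 := hf (.pos (.R a)) (by simp)
    simp only [Literal.Falsified, RLNPVar.assignment] at h1 h2 h3
    simp only [h2, true_and, not_true, false_and, or_false] at h1
    exact h3 (h1 ▸ h.mapsTo b h2)
  · have h1 := hf (.neg (.S a b)) (by simp)
    have h2 := hf (.neg (.R b)) (by simp)
    have h3 := hf (.pos (.L a b)) (by simp)
    simp only [Literal.Falsified, RLNPVar.assignment] at h1 h2 h3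
    simp only [h2, true_and, not_true, false_and, or_false] at h1
    subst h1
    have h4 := h.lt_witness b
      (mem_clauseScope (l := .neg (.S (f b) b)) (by simp) (by simp [Literal.var, RLNPVar.scope])) h2
    have h5 := h.mapsTo b h2
    exact h3 (Or.inl ⟨h5, h2, h4⟩)
  · exact hf (.pos (.R a)) (by simp) (hlast a ha)

/-- If sound positions occur only at clauses with few kept elements in their scope, the adversary
can play from the empty clause down to an initial clause. -/
theorem ResolutionRefutation.exists_initial_position {n : ℕ} {F : Set (Clause (RLNPVar n))}
    (ρ : ResolutionRefutation F) (K : Finset (Fin n)) (hK : K.Nonempty) (β : RLNPVar n → Prop)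
    (hsmall : ∀ i depth f, Position K β (ρ.label i) depth f →
      2 * #(clauseScope (ρ.label i) ∩ K) + 2 < #K) :
    ∃ i depth f, Position K β (ρ.label i) depth f ∧ ρ.label i ∈ F := by
  by_contra! hcon
  have key : ∀ m : ℕ, ∀ i : Fin ρ.size, (i : ℕ) = m →
      ∀ depth f, ¬ Position K β (ρ.label i) depth f := by
    intro m
    induction m using Nat.strong_induction_on with
    | _ m ih =>
    rintro i rfl depth f hp
    rcases ρ.derived i with hF | ⟨a, ha, hsub⟩ | ⟨a, b, ha, hb, hres⟩
    · exact hcon i depth f hp hF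
    · exact ih a ha a rfl depth f (hp.mono hsub)
    · obtain ⟨x, hx⟩ := hres.exists_falsified_premise
      obtain ⟨depth', f', hp', hnew⟩ := hp.exists_extension (hsmall i depth f hp) x
      obtain ⟨G, hG, hGf, l, rfl, hl⟩ := hx _ hp'.falsifies
      have hGp : Position K β G depth' f' := by
        refine ⟨hp'.mapsTo, fun j hj hjK => ?_, hGf⟩
        have := clauseScope_mono hl hj
        rw [clauseScope_insert, mem_union] at this
        exact this.elim (fun h => hnew j h hjK) (fun h => hp'.lt_witness j h hjK)
      rcases hG with rfl | rfl
      · exact ih a ha a rfl _ _ hGp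
      · exact ih b hb b rfl _ _ hGp
  obtain ⟨i, hi⟩ := ρ.refutes
  obtain ⟨z, hz⟩ := hK
  refine key i i rfl (fun _ => 0) (fun _ => z) ⟨fun _ _ => hz, ?_, ?_⟩ <;> rw [hi]
  · intro j hj
    simp [clauseScope, clauseVars] at hj
  · intro l hl
    simp at hl

/-! ### The cost of a falsified parameterized clause -/

/-- A strict order given by a rank function has at most `m (m - 1) / 2` pairs on `m` elements. -/
theorem two_mul_card_pairs_lt_add_card_le {α : Type*} [DecidableEq α] (D : Finset α) (g : α → ℕ) :
    2 * #{p ∈ D ×ˢ D | g p.2 < g p.1} + #D ≤ #D * #D := by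
  set P := {p ∈ D ×ˢ D | g p.2 < g p.1} with hP
  have hmem : ∀ p, p ∈ P ↔ (p.1 ∈ D ∧ p.2 ∈ D) ∧ g p.2 < g p.1 := by
    intro p; simp [hP]
  have hdisj : Disjoint P (P.map (Equiv.prodComm α α).toEmbedding) := by
    rw [disjoint_left]
    intro p hp hp'
    obtain ⟨q, hq, rfl⟩ := mem_map.1 hp'
    have h1 := ((hmem _).1 hp).2
    have h2 := ((hmem _).1 hq).2
    simp at h1
    omega
  have hsub : P ∪ P.map (Equiv.prodComm α α).toEmbedding ⊆ D.offDiag := by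
    intro p hp
    rw [mem_offDiag]
    rcases mem_union.1 hp with hp | hp
    · obtain ⟨⟨h1, h2⟩, h3⟩ := (hmem _).1 hp
      exact ⟨h1, h2, fun e => by rw [e] at h3; exact lt_irrefl _ h3⟩
    · obtain ⟨q, hq, rfl⟩ := mem_map.1 hp
      obtain ⟨⟨h1, h2⟩, h3⟩ := (hmem _).1 hq
      exact ⟨h2, h1, fun e => by
        have e' : q.2 = q.1 := e
        rw [e'] at h3; exact lt_irrefl _ h3⟩
  have h := card_le_card hsub
  rw [card_union_of_disjoint hdisj, card_map, offDiag_card] at h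
  have : #D ≤ #D * #D := Nat.le_mul_self _
  omega

/-- A nonempty finite set cannot send each of its elements to one of larger rank. -/
theorem card_filter_witness_lt {α : Type*} [DecidableEq α] {D : Finset α} (hD : D.Nonempty)
    (g : α → ℕ) (f : α → α) : #{j ∈ D | f j ∈ D ∧ g j < g (f j)} < #D := by
  obtain ⟨z, hz, hmax⟩ := exists_max_image D g hD
  refine card_lt_card ⟨filter_subset _ _, fun h => ?_⟩
  have := (mem_filter.1 (h hz)).2
  exact absurd this.2 (not_lt.2 (hmax _ this.1))

/-- The variables on the elements of `D` that can be true together, when `L` is a strict order and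
every element except the least has one witness: there are at most
`m + (m - 1) + m (m - 1) / 2` of them for `m = #D`. -/
theorem two_mul_card_le_of_true_on {n : ℕ} {D : Finset (Fin n)} (hD : D.Nonempty)
    (depth : Fin n → ℕ) (f : Fin n → Fin n) (U : Finset (RLNPVar n))
    (hR : ∀ i, RLNPVar.R i ∈ U → i ∈ D)
    (hL : ∀ i j, RLNPVar.L i j ∈ U → i ∈ D ∧ j ∈ D ∧ depth j < depth i)
    (hS : ∀ i j, RLNPVar.S i j ∈ U → j ∈ D ∧ f j = i ∧ i ∈ D ∧ depth j < depth i) :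
    2 * #U + 2 ≤ #D * #D + 3 * #D := by
  classical
  have hsub : U ⊆ D.image RLNPVar.R ∪
      ({p ∈ D ×ˢ D | depth p.2 < depth p.1}.image fun p => RLNPVar.L p.1 p.2) ∪
      ({j ∈ D | f j ∈ D ∧ depth j < depth (f j)}.image fun j => RLNPVar.S (f j) j) := by
    intro v hv
    simp only [mem_union, mem_image, mem_filter, mem_product]
    cases v with
    | R i => exact Or.inl (Or.inl ⟨i, hR i hv, rfl⟩)
    | L i j =>
      obtain ⟨h1, h2, h3⟩ := hL i j hv
      exact Or.inl (Or.inr ⟨(i, j), ⟨⟨h1, h2⟩, h3⟩, rfl⟩)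
    | S i j =>
      obtain ⟨h1, rfl, h2, h3⟩ := hS i j hv
      exact Or.inr ⟨j, ⟨h1, h2, h3⟩, rfl⟩
  have h := (card_le_card hsub).trans ((card_union_le _ _).trans
    (add_le_add (card_union_le _ _) le_rfl))
  have h1 := card_image_le (s := D) (f := RLNPVar.R)
  have h2 := card_image_le (s := {p ∈ D ×ˢ D | depth p.2 < depth p.1})
    (f := fun p => RLNPVar.L p.1 p.2)
  have h3 := card_image_le (s := {j ∈ D | f j ∈ D ∧ depth j < depth (f j)})
    (f := fun j => RLNPVar.S (f j) j)
  have h4 := two_mul_card_pairs_lt_add_card_le D depth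
  have h5 := card_filter_witness_lt hD depth f
  omega

/-- With `r` selected elements and `b` true bits, at least `k + 1` true variables force the total
weight above `√(100 k)`. The weights `14` and `5` are small enough to leave `t ^ 6 = t ^ (20 - 14)`
kept elements, more than the inverse probability `t ^ 5` of a bit, and large enough
for `k ≥ 5`; no such weights work for `k ≤ 4`. -/
theorem hundred_mul_lt_sq {k r b : ℕ} (hk : 5 ≤ k) (h : 2 * k ≤ r * r + 5 * r + 2 * b) :
    100 * k < (14 * r + 5 * b) * (14 * r + 5 * b) := by
  rcases Nat.lt_or_ge r 2 with hr | hr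
  · interval_cases r
    · nlinarith
    · nlinarith
  · have : 2 * b ≤ r * b := Nat.mul_le_mul_right _ hr
    nlinarith

/-- A sound position that falsifies a clause of `k + 1` negative literals pays for it: many kept
elements other than `last`, at weight `14`, and many preset bits of value true, at weight `5`. -/
theorem Position.exists_cost {n k : ℕ} (hk : 5 ≤ k) {K : Finset (Fin n)} {β : RLNPVar n → Prop}
    {T : Finset (RLNPVar n)} (hT : #T = k + 1) {depth : Fin n → ℕ} {f : Fin n → Fin n}
    (h : Position K β (T.image Literal.neg) depth f) (last : Fin n) :
    ∃ A ⊆ T.biUnion RLNPVar.elements, ∃ T' ⊆ T, A ⊆ K.erase last ∧ (∀ v ∈ T', β v) ∧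
      Nat.sqrt (100 * k) + 1 ≤ 14 * #A + 5 * #T' := by
  classical
  set U := {v ∈ T | ¬ v.Preset K} with hU
  have htrue : ∀ v ∈ T, RLNPVar.assignment K β depth f v := fun v hv =>
    h.falsifies (.neg v) (mem_image_of_mem _ hv)
  have hUK : ∀ v ∈ U, v.elements ⊆ K := by
    intro v hv
    obtain ⟨hvT, hvp⟩ := mem_filter.1 hv
    have := htrue v hvT
    cases v with
    | R i => exact singleton_subset_iff.2 this
    | L i j =>
      have := not_not.1 hvp
      simp [RLNPVar.elements, insert_subset_iff, this]
    | S i j =>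
      have hj : j ∈ K := not_not.1 hvp
      simp only [RLNPVar.assignment, hj, true_and, not_true, false_and, or_false] at this
      have := this ▸ h.mapsTo j hj
      simp [RLNPVar.elements, insert_subset_iff, this, hj]
  set A := (U.biUnion RLNPVar.elements).erase last with hA
  set D := insert last A with hD
  have hmemD : ∀ v ∈ U, ∀ i ∈ v.elements, i ∈ D := by
    intro v hv i hi
    by_cases hil : i = last
    · simp [hD, hil]
    · exact mem_insert_of_mem (mem_erase.2 ⟨hil, mem_biUnion.2 ⟨v, hv, hi⟩⟩)
  have hUcard : 2 * #U + 2 ≤ #D * #D + 3 * #D := by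
    refine two_mul_card_le_of_true_on ⟨last, mem_insert_self _ _⟩ depth f U ?_ ?_ ?_
    · intro i hi
      exact hmemD _ hi i (by simp [RLNPVar.elements])
    · intro i j hi
      refine ⟨hmemD _ hi i (by simp [RLNPVar.elements]),
        hmemD _ hi j (by simp [RLNPVar.elements]), ?_⟩
      obtain ⟨hvT, hvp⟩ := mem_filter.1 hi
      have := htrue _ hvT
      simp only [RLNPVar.Preset, RLNPVar.assignment] at this hvp
      tauto
    · intro i j hi
      obtain ⟨hvT, hvp⟩ := mem_filter.1 hi
      have := htrue _ hvT
      simp only [RLNPVar.Preset, RLNPVar.assignment, not_not] at this hvp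
      simp only [hvp, true_and, not_true, false_and, or_false] at this
      refine ⟨hmemD _ hi j (by simp [RLNPVar.elements]), this,
        hmemD _ hi i (by simp [RLNPVar.elements]), ?_⟩
      rw [← this]
      exact h.lt_witness j (mem_clauseScope (mem_image_of_mem _ hvT)
        (by simp [Literal.var, RLNPVar.scope])) hvp
  have hDcard : #D = #A + 1 := card_insert_of_notMem (notMem_erase _ _)
  have hsplit : #{v ∈ T | v.Preset K} + #U = k + 1 := by
    rw [← hT, hU]; exact card_filter_add_card_filter_not _
  refine ⟨A, ?_, {v ∈ T | v.Preset K}, filter_subset _ _, ?_, ?_, ?_⟩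
  · exact (erase_subset _ _).trans (biUnion_subset_biUnion_of_subset_left _ (filter_subset _ _))
  · exact erase_subset_erase _ (biUnion_subset.2 hUK)
  · intro v hv
    obtain ⟨hvT, hvp⟩ := mem_filter.1 hv
    exact (RLNPVar.assignment_of_preset hvp).1 (htrue v hvT)
  · apply Nat.succ_le_of_lt
    rw [Nat.sqrt_lt]
    apply hundred_mul_lt_sq hk
    rw [hDcard] at hUcard
    nlinarith

/-! ### Counting random restrictions -/

/-- A product-counting bound: if for each coordinate in `V` at most a fraction `x` of the values is
allowed, then at most a fraction `x ^ #V` of the functions is allowed. -/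
theorem card_filter_forall_mem_le {ι α : Type*} [Fintype ι] [DecidableEq ι] [Fintype α]
    [DecidableEq α] (V : Finset ι) (S : ι → Finset α) {x : ℝ}
    (hS : ∀ i ∈ V, (#(S i) : ℝ) ≤ x * Fintype.card α) :
    (#{g : ι → α | ∀ i ∈ V, g i ∈ S i} : ℝ) ≤ x ^ #V * Fintype.card (ι → α) := by
  have h1 : ({g : ι → α | ∀ i ∈ V, g i ∈ S i} : Finset (ι → α)) =
      Fintype.piFinset fun i => if i ∈ V then S i else univ := by
    ext g
    simp only [mem_filter, mem_univ, true_and, Fintype.mem_piFinset]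
    refine forall_congr' fun i => ?_
    by_cases hi : i ∈ V <;> simp [hi]
  have h2 : x ^ #V * (Fintype.card (ι → α) : ℝ) =
      ∏ i : ι, (if i ∈ V then x else 1) * (Fintype.card α : ℝ) := by
    rw [prod_mul_distrib, prod_ite_mem, univ_inter, prod_const, prod_const, Fintype.card_fun,
      card_univ]
    push_cast
    rfl
  rw [h1, h2, Fintype.card_piFinset]
  push_cast
  refine prod_le_prod (fun _ _ => by positivity) fun i _ => ?_
  by_cases hi : i ∈ V
  · simpa [hi] using hS i hi
  · simp [hi]

/-- The elements selected by `κ`, one in each block of the embedded array `e`. -/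
def selected {d B n : ℕ} (e : Fin d × Fin B ↪ Fin n) (κ : Fin d → Fin B) : Finset (Fin n) :=
  univ.image fun b => e (b, κ b)

theorem mem_selected {d B n : ℕ} {e : Fin d × Fin B ↪ Fin n} {κ : Fin d → Fin B} {i : Fin n} :
    i ∈ selected e κ ↔ ∃ b, e (b, κ b) = i := by simp [selected]

theorem card_selected {d B n : ℕ} (e : Fin d × Fin B ↪ Fin n) (κ : Fin d → Fin B) :
    #(selected e κ) = d := by
  rw [selected, card_image_of_injective, card_univ, Fintype.card_fin]
  intro a b h
  exact congrArg Prod.fst (e.injective h)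

/-- A given set `A` of elements is selected with probability at most `B ^ (-#A)`. -/
theorem card_filter_subset_selected_le {d B n : ℕ} (hB : 0 < B) (e : Fin d × Fin B ↪ Fin n)
    (A : Finset (Fin n)) :
    (#{κ : Fin d → Fin B | A ⊆ selected e κ} : ℝ) ≤
      (1 / B : ℝ) ^ #A * Fintype.card (Fin d → Fin B) := by
  by_cases h : ∃ κ₀, A ⊆ selected e κ₀
  · obtain ⟨κ₀, h₀⟩ := h
    set V : Finset (Fin d) := {b | e (b, κ₀ b) ∈ A} with hV
    have hAV : A = V.image fun b => e (b, κ₀ b) := by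
      ext i
      simp only [mem_image, hV, mem_filter, mem_univ, true_and]
      constructor
      · intro hi
        obtain ⟨b, rfl⟩ := mem_selected.1 (h₀ hi)
        exact ⟨b, hi, rfl⟩
      · rintro ⟨b, hb, rfl⟩
        exact hb
    have hcard : #A = #V := by
      conv_lhs => rw [hAV]
      exact card_image_of_injective _ fun a b h => congrArg Prod.fst (e.injective h)
    rw [hcard]
    refine le_trans ?_ (card_filter_forall_mem_le V (fun b => {κ₀ b}) ?_)
    · refine Nat.cast_le.2 (card_le_card fun κ hκ => ?_)
      simp only [mem_filter, mem_univ, true_and, mem_singleton] at hκ ⊢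
      intro b hb
      obtain ⟨b', hb'⟩ := mem_selected.1 (hκ ((mem_filter.1 hb).2))
      have := e.injective hb'
      obtain ⟨rfl, h⟩ := Prod.mk.inj this
      exact h
    · intro b _
      have : (B : ℝ) ≠ 0 := by positivity
      simp [this]
  · push Not at h
    rw [filter_false_of_mem fun κ _ => h κ]
    simp only [card_empty, Nat.cast_zero]
    positivity

/-- At least `W` elements of a set of `s` elements are selected with probability at most
`(s / B) ^ W`. -/
theorem card_filter_le_card_inter_selected_le {d B n : ℕ} (hB : 0 < B)
    (e : Fin d × Fin B ↪ Fin n) (J : Finset (Fin n)) (W : ℕ) :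
    (#{κ : Fin d → Fin B | W ≤ #(J ∩ selected e κ)} : ℝ) ≤
      (#J / B : ℝ) ^ W * Fintype.card (Fin d → Fin B) := by
  have hsub : ({κ : Fin d → Fin B | W ≤ #(J ∩ selected e κ)} : Finset _) ⊆
      (J.powersetCard W).biUnion fun A => {κ | A ⊆ selected e κ} := by
    intro κ hκ
    obtain ⟨A, hA, hAc⟩ := exists_subset_card_eq (mem_filter.1 hκ).2
    refine mem_biUnion.2 ⟨A, mem_powersetCard.2 ⟨hA.trans inter_subset_left, hAc⟩, ?_⟩
    simpa using hA.trans inter_subset_right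
  calc (#{κ : Fin d → Fin B | W ≤ #(J ∩ selected e κ)} : ℝ)
      ≤ ∑ A ∈ J.powersetCard W, (#{κ : Fin d → Fin B | A ⊆ selected e κ} : ℝ) := by
        exact_mod_cast (card_le_card hsub).trans card_biUnion_le
    _ ≤ ∑ A ∈ J.powersetCard W, (1 / B : ℝ) ^ W * Fintype.card (Fin d → Fin B) := by
        refine sum_le_sum fun A hA => ?_
        rw [← (mem_powersetCard.1 hA).2]
        exact card_filter_subset_selected_le hB e A
    _ = (#J).choose W * ((1 / B : ℝ) ^ W * Fintype.card (Fin d → Fin B)) := by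
        rw [sum_const, card_powersetCard, nsmul_eq_mul]
    _ ≤ (#J : ℝ) ^ W * ((1 / B : ℝ) ^ W * Fintype.card (Fin d → Fin B)) := by
        gcongr
        exact_mod_cast Nat.choose_le_pow _ _
    _ = _ := by rw [← mul_assoc, ← mul_pow]; congr 2; ring

/-! ### The bad events of a random restriction -/

section Restriction

variable {n d B P : ℕ}

/-- The kept elements: the selected ones and `last`. -/
def kept (last : Fin n) (e : Fin d × Fin B ↪ Fin n) (κ : Fin d → Fin B) : Finset (Fin n) :=
  insert last (selected e κ)

/-- The truth values encoded by `P`-valued labels: a variable is true with probability `1 / P`. -/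
def bits (β : RLNPVar n → Fin P) (v : RLNPVar n) : Prop := (β v : ℕ) = 0

instance : Fintype (RLNPVar n) :=
  Fintype.ofEquiv (Fin n ⊕ (Fin n × Fin n) ⊕ (Fin n × Fin n))
    { toFun := Sum.elim RLNPVar.R
        (Sum.elim (fun p => RLNPVar.L p.1 p.2) (fun p => RLNPVar.S p.1 p.2))
      invFun := fun
        | .R i => Sum.inl i
        | .L i j => Sum.inr (Sum.inl (i, j))
        | .S i j => Sum.inr (Sum.inr (i, j))
      left_inv := by rintro (i | p | p) <;> rfl
      right_inv := by rintro (i | _ | _) <;> rfl }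

open scoped Classical in
/-- The variables of a clause that are set independently of the adversary. -/
noncomputable def presetVars (K : Finset (Fin n)) (C : Clause (RLNPVar n)) :
    Finset (RLNPVar n) :=
  {v ∈ clauseVars C | v.Preset K}

/-- A clause with at least `d` preset variables is not satisfied by any of them. -/
def WideSurvives (last : Fin n) (e : Fin d × Fin B ↪ Fin n) (C : Clause (RLNPVar n))
    (ω : (Fin d → Fin B) × (RLNPVar n → Fin P)) : Prop :=
  d ≤ #(presetVars (kept last e ω.1) C) ∧
    ∀ l ∈ C, l.var.Preset (kept last e ω.1) → l.Falsified (bits ω.2)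

/-- Unusually many elements, at least `W`, are selected from the scope of a clause, although the
scope is at most about three times as large as the set of all selected elements. -/
def ManySelected (e : Fin d × Fin B ↪ Fin n) (W : ℕ) (C : Clause (RLNPVar n))
    (ω : (Fin d → Fin B) × (RLNPVar n → Fin P)) : Prop :=
  #(clauseScope C) ≤ 3 * d + 1 ∧ W ≤ #(clauseScope C ∩ selected e ω.1)

/-- The cost of a falsified parameterized clause is paid: among its elements and variables there are
selected elements and true bits of total weight at least `W`. -/
def CostPaid (e : Fin d × Fin B ↪ Fin n) (k W : ℕ) (C : Clause (RLNPVar n))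
    (ω : (Fin d → Fin B) × (RLNPVar n → Fin P)) : Prop :=
  #(clauseVars C) ≤ k + 1 ∧ ∃ A ⊆ (clauseVars C).biUnion RLNPVar.elements, ∃ T ⊆ clauseVars C,
    A ⊆ selected e ω.1 ∧ (∀ v ∈ T, bits ω.2 v) ∧ W ≤ 14 * #A + 5 * #T

open scoped Classical in
/-- For a fixed selection the preset bits are independent, and each of them satisfies its literal
with probability at least `1 / P`. -/
theorem card_wideSurvives_le (hP : 2 ≤ P) (last : Fin n) (e : Fin d × Fin B ↪ Fin n)
    (C : Clause (RLNPVar n)) :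
    (#{ω : (Fin d → Fin B) × (RLNPVar n → Fin P) | WideSurvives last e C ω} : ℝ) ≤
      (1 - 1 / P : ℝ) ^ d * Fintype.card ((Fin d → Fin B) × (RLNPVar n → Fin P)) := by
  have hP' : (2 : ℝ) ≤ P := by exact_mod_cast hP
  have hx0 : (0 : ℝ) ≤ 1 - 1 / P := by
    rw [sub_nonneg, div_le_one (by linarith)]; linarith
  have hx1 : (1 - 1 / P : ℝ) ≤ 1 := by
    rw [sub_le_self_iff]; positivity
  have hfib : ∀ κ : Fin d → Fin B,
      (#{β : RLNPVar n → Fin P | WideSurvives last e C (κ, β)} : ℝ) ≤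
        (1 - 1 / P : ℝ) ^ d * Fintype.card (RLNPVar n → Fin P) := by
    intro κ
    by_cases hd : d ≤ #(presetVars (kept last e κ) C)
    · set V := presetVars (kept last e κ) C with hV
      have hcard : ∀ v ∈ V,
          (#{a : Fin P | if Literal.pos v ∈ C then (a : ℕ) ≠ 0 else (a : ℕ) = 0} : ℝ) ≤
            (1 - 1 / P : ℝ) * Fintype.card (Fin P) := by
        intro v _
        have h0 : #{a : Fin P | (a : ℕ) = 0} = 1 := by
          rw [card_eq_one]
          refine ⟨⟨0, by omega⟩, ?_⟩
          ext a
          simp [Fin.ext_iff]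
        have h1 : #{a : Fin P | (a : ℕ) = 0} + #{a : Fin P | ¬ (a : ℕ) = 0} = P := by
          rw [card_filter_add_card_filter_not]; simp
        have h2 : (1 - 1 / P : ℝ) * Fintype.card (Fin P) = P - 1 := by
          rw [Fintype.card_fin]; field_simp
        rw [h2]
        split_ifs
        · have : (#{a : Fin P | (a : ℕ) ≠ 0} : ℝ) + 1 = P := by
            rw [h0] at h1; exact_mod_cast (add_comm _ _).trans h1
          linarith
        · rw [h0]; push_cast; linarith
      refine le_trans ?_ ((card_filter_forall_mem_le V
        (fun v => {a : Fin P | if Literal.pos v ∈ C then (a : ℕ) ≠ 0 else (a : ℕ) = 0})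
        hcard).trans ?_)
      · refine Nat.cast_le.2 (card_le_card fun β hβ => ?_)
        obtain ⟨-, hβ⟩ := (mem_filter.1 hβ).2
        simp only [mem_filter, mem_univ, true_and]
        intro v hv
        obtain ⟨hvC, hvp⟩ := mem_filter.1 hv
        split_ifs with hpos
        · exact hβ _ hpos hvp
        · obtain ⟨l, hl, rfl⟩ := mem_image.1 hvC
          cases l with
          | pos v => exact absurd hl hpos
          | neg v => exact hβ _ hl hvp
      · exact mul_le_mul_of_nonneg_right (pow_le_pow_of_le_one hx0 hx1 hd) (by positivity)
    · rw [filter_false_of_mem fun β _ h => hd h.1]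
      simp only [card_empty, Nat.cast_zero]
      positivity
  calc (#{ω : (Fin d → Fin B) × (RLNPVar n → Fin P) | WideSurvives last e C ω} : ℝ)
      = ∑ κ : Fin d → Fin B, (#{β : RLNPVar n → Fin P | WideSurvives last e C (κ, β)} : ℝ) := by
        simp only [card_filter, Nat.cast_sum]
        rw [Fintype.sum_prod_type]
    _ ≤ ∑ _κ : Fin d → Fin B, (1 - 1 / P : ℝ) ^ d * Fintype.card (RLNPVar n → Fin P) :=
        sum_le_sum fun κ _ => hfib κ
    _ = _ := by
        rw [sum_const, card_univ, nsmul_eq_mul, Fintype.card_prod]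
        push_cast
        ring

open scoped Classical in
theorem card_manySelected_le (hB : 0 < B) (e : Fin d × Fin B ↪ Fin n) (W : ℕ)
    (C : Clause (RLNPVar n)) :
    (#{ω : (Fin d → Fin B) × (RLNPVar n → Fin P) | ManySelected e W C ω} : ℝ) ≤
      ((3 * d + 1) / B : ℝ) ^ W * Fintype.card ((Fin d → Fin B) × (RLNPVar n → Fin P)) := by
  by_cases hJ : #(clauseScope C) ≤ 3 * d + 1
  · have hsub : ({ω : (Fin d → Fin B) × (RLNPVar n → Fin P) | ManySelected e W C ω} : Finset _) ⊆
        ({κ | W ≤ #(clauseScope C ∩ selected e κ)} : Finset _) ×ˢ univ := by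
      intro ω hω
      simpa using (mem_filter.1 hω).2.2
    have hJ' : (#(clauseScope C) : ℝ) ≤ 3 * d + 1 := by exact_mod_cast hJ
    calc (#{ω : (Fin d → Fin B) × (RLNPVar n → Fin P) | ManySelected e W C ω} : ℝ)
        ≤ #{κ | W ≤ #(clauseScope C ∩ selected e κ)} *
            (Fintype.card (RLNPVar n → Fin P) : ℝ) := by
          have := card_le_card hsub
          rw [card_product, card_univ] at this
          exact_mod_cast this
      _ ≤ ((#(clauseScope C) / B : ℝ) ^ W * Fintype.card (Fin d → Fin B)) *
            (Fintype.card (RLNPVar n → Fin P) : ℝ) := by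
          gcongr
          exact card_filter_le_card_inter_selected_le hB e _ W
      _ ≤ (((3 * d + 1) / B : ℝ) ^ W * Fintype.card (Fin d → Fin B)) *
            (Fintype.card (RLNPVar n → Fin P) : ℝ) := by
          gcongr
      _ = _ := by
          rw [Fintype.card_prod]
          push_cast
          ring
  · rw [filter_false_of_mem fun ω _ h => hJ h.1]
    simp only [card_empty, Nat.cast_zero]
    positivity

open scoped Classical in
/-- With blocks of size `t ^ 14` and bits of probability `t ^ (-5)`, total weight `W` costs
a factor `t ^ (-W)`; the union bound is over the choices of the elements and of the variables. -/
theorem card_costPaid_le {t : ℕ} (ht : 0 < t) (e : Fin d × Fin (t ^ 14) ↪ Fin n) (k W : ℕ)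
    (C : Clause (RLNPVar n)) :
    (#{ω : (Fin d → Fin (t ^ 14)) × (RLNPVar n → Fin (t ^ 5)) | CostPaid e k W C ω} : ℝ) ≤
      8 ^ (k + 1) * (1 / t : ℝ) ^ W *
        Fintype.card ((Fin d → Fin (t ^ 14)) × (RLNPVar n → Fin (t ^ 5))) := by
  have ht' : (1 : ℝ) ≤ t := by exact_mod_cast ht
  set N : ℝ := ((Fintype.card ((Fin d → Fin (t ^ 14)) × (RLNPVar n → Fin (t ^ 5))) : ℕ) : ℝ)
    with hN
  by_cases hC : #(clauseVars C) ≤ k + 1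
  swap
  · rw [filter_false_of_mem fun ω _ h => hC h.1]
    simp only [card_empty, Nat.cast_zero]
    positivity
  set I := {p ∈ ((clauseVars C).biUnion RLNPVar.elements).powerset ×ˢ (clauseVars C).powerset |
    W ≤ 14 * #p.1 + 5 * #p.2} with hI
  set E : Finset (Fin n) × Finset (RLNPVar n) →
      Finset ((Fin d → Fin (t ^ 14)) × (RLNPVar n → Fin (t ^ 5))) := fun p =>
    ({κ | p.1 ⊆ selected e κ} : Finset _) ×ˢ
      ({β | ∀ v ∈ p.2, β v ∈ ({a : Fin (t ^ 5) | (a : ℕ) = 0} : Finset _)} : Finset _) with hE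
  have hsub : ({ω : (Fin d → Fin (t ^ 14)) × (RLNPVar n → Fin (t ^ 5)) | CostPaid e k W C ω} :
      Finset _) ⊆ I.biUnion E := by
    intro ω hω
    obtain ⟨-, A, hA, T, hT, h1, h2, h3⟩ := (mem_filter.1 hω).2
    refine mem_biUnion.2 ⟨(A, T), ?_, ?_⟩
    · simp [hI, hA, hT, h3]
    · simpa [hE, h1, bits] using h2
  have hEcard : ∀ p ∈ I, (#(E p) : ℝ) ≤ (1 / t : ℝ) ^ W * N := by
    intro p hp
    have hW := (mem_filter.1 hp).2
    have h1 := card_filter_subset_selected_le (pow_pos ht 14) e p.1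
    have h2 := card_filter_forall_mem_le p.2 (fun _ => ({a : Fin (t ^ 5) | (a : ℕ) = 0} : Finset _))
      (x := 1 / ((t ^ 5 : ℕ) : ℝ)) (by
        intro v _
        have h0 : #{a : Fin (t ^ 5) | (a : ℕ) = 0} = 1 := by
          rw [card_eq_one]
          refine ⟨⟨0, pow_pos ht 5⟩, ?_⟩
          ext a
          simp [Fin.ext_iff]
        have : ((t ^ 5 : ℕ) : ℝ) ≠ 0 := by positivity
        rw [h0, Fintype.card_fin, one_div_mul_cancel this, Nat.cast_one])
    calc (#(E p) : ℝ) = _ * _ := by rw [hE, card_product]; push_cast; rfl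
      _ ≤ _ := mul_le_mul h1 h2 (by positivity) (by positivity)
      _ = (1 / t : ℝ) ^ (14 * #p.1 + 5 * #p.2) * N := by
          rw [hN, Fintype.card_prod, pow_add, pow_mul, pow_mul]
          push_cast
          simp only [one_div, inv_pow]
          ring
      _ ≤ (1 / t : ℝ) ^ W * N := by
          gcongr ?_ * N
          exact pow_le_pow_of_le_one (by positivity)
            ((div_le_one (by linarith)).2 ht') hW
  have hIcard : #I ≤ 8 ^ (k + 1) := by
    have hel : #((clauseVars C).biUnion RLNPVar.elements) ≤ (k + 1) * 2 := by
      refine (card_biUnion_le_card_mul _ _ 2 fun v _ => ?_).trans (Nat.mul_le_mul_right _ hC)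
      cases v <;> simp [RLNPVar.elements, card_le_two]
    calc #I ≤ _ := card_filter_le _ _
      _ = 2 ^ #((clauseVars C).biUnion RLNPVar.elements) * 2 ^ #(clauseVars C) := by
          rw [card_product, card_powerset, card_powerset]
      _ ≤ 2 ^ ((k + 1) * 2) * 2 ^ (k + 1) :=
          Nat.mul_le_mul (Nat.pow_le_pow_right two_pos hel) (Nat.pow_le_pow_right two_pos hC)
      _ = 8 ^ (k + 1) := by
          rw [← pow_add, show (k + 1) * 2 + (k + 1) = 3 * (k + 1) by ring, pow_mul]; norm_num
  calc (#{ω : (Fin d → Fin (t ^ 14)) × (RLNPVar n → Fin (t ^ 5)) | CostPaid e k W C ω} : ℝ)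
      ≤ ∑ p ∈ I, (#(E p) : ℝ) := by exact_mod_cast (card_le_card hsub).trans card_biUnion_le
    _ ≤ ∑ _p ∈ I, (1 / t : ℝ) ^ W * N := sum_le_sum hEcard
    _ = #I * ((1 / t : ℝ) ^ W * N) := by rw [sum_const, nsmul_eq_mul]
    _ ≤ ((8 ^ (k + 1) : ℕ) : ℝ) * ((1 / t : ℝ) ^ W * N) := by gcongr
    _ = _ := by push_cast; ring

/-- A clause falsified by a sound position has few kept elements in its scope, if it escapes the
first two bad events: at most `d - 1` preset variables survive, so the scope has at
most `2 (d - 1)` discarded elements and at most `d + 1` kept ones. -/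
theorem Position.card_scope_inter_kept_le {last : Fin n} {e : Fin d × Fin B ↪ Fin n} {W : ℕ}
    {C : Clause (RLNPVar n)} {ω : (Fin d → Fin B) × (RLNPVar n → Fin P)}
    {depth : Fin n → ℕ} {f : Fin n → Fin n}
    (h : Position (kept last e ω.1) (bits ω.2) C depth f)
    (h1 : ¬ WideSurvives last e C ω) (h2 : ¬ ManySelected e W C ω) :
    #(presetVars (kept last e ω.1) C) < d ∧ #(clauseScope C ∩ kept last e ω.1) ≤ W := by
  classical
  set K := kept last e ω.1 with hK
  have hKcard : #K ≤ d + 1 := (card_insert_le _ _).trans (by rw [card_selected])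
  have hpre : #(presetVars K C) < d := by
    by_contra! hd
    refine h1 ⟨hd, fun l hl hp => ?_⟩
    have hf := h.falsifies l hl
    have := RLNPVar.assignment_of_preset (β := bits ω.2) (depth := depth) (f := f) hp
    cases l with
    | pos v => exact fun hb => hf (this.2 hb)
    | neg v => exact this.1 hf
  refine ⟨hpre, ?_⟩
  have hout : clauseScope C \ K ⊆ (presetVars K C).biUnion RLNPVar.scope := by
    intro j hj
    obtain ⟨hjC, hjK⟩ := mem_sdiff.1 hj
    obtain ⟨v, hv, hjv⟩ := mem_biUnion.1 hjC
    refine mem_biUnion.2 ⟨v, mem_filter.2 ⟨hv, ?_⟩, hjv⟩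
    cases v with
    | R i => simp [RLNPVar.scope] at hjv
    | L i l =>
      simp only [RLNPVar.scope, mem_insert, mem_singleton] at hjv
      rintro ⟨hi, hl⟩
      rcases hjv with rfl | rfl
      exacts [hjK hi, hjK hl]
    | S i l =>
      simp only [RLNPVar.scope, mem_singleton] at hjv
      exact hjv ▸ hjK
  have hout' : #(clauseScope C \ K) ≤ #(presetVars K C) * 2 :=
    (card_le_card hout).trans (card_biUnion_le_card_mul _ _ 2 fun v _ => by
      cases v <;> simp [RLNPVar.scope, card_le_two])
  have hin : #(clauseScope C ∩ K) ≤ d + 1 := (card_le_card inter_subset_right).trans hKcard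
  have hJ : #(clauseScope C) ≤ 3 * d + 1 := by
    have := card_sdiff_add_card_inter (clauseScope C) K
    omega
  have hsel : #(clauseScope C ∩ selected e ω.1) < W := by
    by_contra! hW
    exact h2 ⟨hJ, hW⟩
  have : clauseScope C ∩ K ⊆ insert last (clauseScope C ∩ selected e ω.1) := by
    intro j hj
    obtain ⟨hj1, hj2⟩ := mem_inter.1 hj
    rcases mem_insert.1 hj2 with rfl | hj2
    · exact mem_insert_self _ _
    · exact mem_insert_of_mem (mem_inter.2 ⟨hj1, hj2⟩)
  have := (card_le_card this).trans (card_insert_le _ _)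
  omega

/-- Every restriction meets one of the three bad events at some clause of any refutation. -/
theorem exists_bad_event {k : ℕ} (hk : 5 ≤ k) (ρ : PResRefutation (RLNP n) k)
    {last : Fin n} (hlast : (last : ℕ) + 1 = n) (e : Fin d × Fin B ↪ Fin n)
    (he : ∀ p, e p ≠ last) (hdn : d ≤ n) (hd : 2 * (Nat.sqrt (100 * k) + 1) + 2 ≤ d)
    (ω : (Fin d → Fin B) × (RLNPVar n → Fin P)) :
    ∃ i, WideSurvives last e (ρ.label i) ω ∨
      ManySelected e (Nat.sqrt (100 * k) + 1) (ρ.label i) ω ∨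
      CostPaid e k (Nat.sqrt (100 * k) + 1) (ρ.label i) ω := by
  classical
  by_contra! hcon
  have hKcard : #(kept last e ω.1) = d + 1 := by
    rw [kept, card_insert_of_notMem, card_selected]
    rw [mem_selected]
    rintro ⟨b, hb⟩
    exact he _ hb
  obtain ⟨i, depth, f, hp, hF | hF⟩ := ρ.exists_initial_position (kept last e ω.1)
    ⟨last, mem_insert_self _ _⟩ (bits ω.2) (fun i depth f hp => by
      have := (hp.card_scope_inter_kept_le (hcon i).1 (hcon i).2.1).2
      omega)
  · refine hp.notMem_RLNP (fun i hi => ?_) (fun j hj hC => ?_) hF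
    · rw [show i = last from Fin.ext (by omega)]
      exact mem_insert_self _ _
    · -- all `n ≥ d` variables of this clause are preset, so one of them satisfies it
      exfalso
      have hpre := (hp.card_scope_inter_kept_le (hcon i).1 (hcon i).2.1).1
      have hsub : univ.image (fun a => RLNPVar.S a j) ⊆
          presetVars (kept last e ω.1) (ρ.label i) := by
        intro v hv
        obtain ⟨a, -, rfl⟩ := mem_image.1 hv
        refine mem_filter.2 ⟨mem_image.2 ⟨.pos (.S a j), ?_, rfl⟩, hj⟩
        rw [hC]
        exact mem_image_of_mem _ (mem_univ a)
      have := card_le_card hsub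
      rw [card_image_of_injective _ (fun a b h => by cases h; rfl), card_univ,
        Fintype.card_fin] at this
      omega
  · obtain ⟨T, hT, hC⟩ := hF
    rw [hC] at hp
    obtain ⟨A, hA, T', hT', h1, h2, h3⟩ := hp.exists_cost hk hT last
    have hvars : clauseVars (ρ.label i) = T := by
      rw [hC, clauseVars, image_image]
      exact image_id
    refine (hcon i).2.2 ⟨by rw [hvars, hT], A, by rwa [hvars], T', by rwa [hvars], ?_, h2, h3⟩
    intro a ha
    obtain ⟨h4, h5⟩ := mem_erase.1 (h1 ha)
    exact (mem_insert.1 h5).resolve_left h4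

/-- The union bound over all clauses of a refutation. -/
theorem one_le_size_mul {k t : ℕ} (hk : 5 ≤ k) (ρ : PResRefutation (RLNP n) k) (ht : 2 ≤ t)
    (htn : t ^ 20 < n) (hd : 2 * (Nat.sqrt (100 * k) + 1) + 2 ≤ t) :
    (1 : ℝ) ≤ ρ.size * ((1 - 1 / (t ^ 5 : ℕ) : ℝ) ^ (t ^ 6) +
      ((3 * (t ^ 6 : ℕ) + 1) / (t ^ 14 : ℕ) : ℝ) ^ (Nat.sqrt (100 * k) + 1) +
      8 ^ (k + 1) * (1 / t : ℝ) ^ (Nat.sqrt (100 * k) + 1)) := by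
  classical
  set W := Nat.sqrt (100 * k) + 1 with hW
  have ht6 : t ≤ t ^ 6 := Nat.le_self_pow (by norm_num) t
  have hP : 2 ≤ t ^ 5 := ht.trans (Nat.le_self_pow (by norm_num) t)
  have hmul : t ^ 6 * t ^ 14 = t ^ 20 := by rw [← pow_add]
  set e : Fin (t ^ 6) × Fin (t ^ 14) ↪ Fin n :=
    finProdFinEquiv.toEmbedding.trans (Fin.castLEEmb (by omega)) with he
  have hlast : (⟨n - 1, by omega⟩ : Fin n).val + 1 = n := by
    simp only; omega
  set Ω := (Fin (t ^ 6) → Fin (t ^ 14)) × (RLNPVar n → Fin (t ^ 5))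
  have hΩ : 0 < (Fintype.card Ω : ℝ) := by
    have : Nonempty (Fin (t ^ 14)) := ⟨⟨0, by positivity⟩⟩
    have : Nonempty (Fin (t ^ 5)) := ⟨⟨0, by positivity⟩⟩
    exact_mod_cast Fintype.card_pos
  have hcover : (univ : Finset Ω) ⊆ univ.biUnion fun i : Fin ρ.size =>
      (({ω | WideSurvives ⟨n - 1, by omega⟩ e (ρ.label i) ω} : Finset Ω) ∪
        ({ω | ManySelected e W (ρ.label i) ω} : Finset Ω)) ∪
          ({ω | CostPaid e k W (ρ.label i) ω} : Finset Ω) := by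
    intro ω _
    obtain ⟨i, hi⟩ := exists_bad_event hk ρ hlast e (fun p hp => by
      have h1 := congrArg Fin.val hp
      have h2 : (e p).val < t ^ 6 * t ^ 14 := (finProdFinEquiv p).isLt
      simp only at h1
      omega) (by
        have : t ^ 6 ≤ t ^ 20 := Nat.pow_le_pow_right (by omega) (by norm_num)
        omega) (hd.trans ht6) ω
    refine mem_biUnion.2 ⟨i, mem_univ _, ?_⟩
    simpa [or_assoc] using hi
  have hsum : (Fintype.card Ω : ℝ) ≤ ∑ i : Fin ρ.size,
      ((#{ω : Ω | WideSurvives ⟨n - 1, by omega⟩ e (ρ.label i) ω} : ℝ) +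
        #{ω : Ω | ManySelected e W (ρ.label i) ω} + #{ω : Ω | CostPaid e k W (ρ.label i) ω}) := by
    have h := (card_le_card hcover).trans card_biUnion_le
    rw [card_univ] at h
    refine (Nat.cast_le.2 h).trans ?_
    rw [Nat.cast_sum]
    refine sum_le_sum fun i _ => ?_
    exact_mod_cast (card_union_le _ _).trans (add_le_add (card_union_le _ _) le_rfl)
  have hbound := hsum.trans (sum_le_sum fun i _ => add_le_add (add_le_add
    (card_wideSurvives_le hP ⟨n - 1, by omega⟩ e (ρ.label i))
    (card_manySelected_le (pow_pos (by omega) 14) e W (ρ.label i)))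
    (card_costPaid_le (by omega) e k W (ρ.label i)))
  simp only [sum_const, card_univ, Fintype.card_fin, nsmul_eq_mul] at hbound
  refine le_of_mul_le_mul_right ?_ hΩ
  rw [one_mul]
  refine hbound.trans (le_of_eq ?_)
  ring

end Restriction

/-! ### Asymptotics -/

/-- For large `t` each of the three bad events costs at most a constant times `t ^ (-W)`. -/
theorem bad_probability_le {t : ℕ} (ht : 2 ≤ t) (W k : ℕ)
    (hexp : (t : ℝ) ^ W * Real.exp (-t) ≤ 1) :
    (1 - 1 / (t ^ 5 : ℕ) : ℝ) ^ (t ^ 6) + ((3 * (t ^ 6 : ℕ) + 1) / (t ^ 14 : ℕ) : ℝ) ^ W +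
      8 ^ (k + 1) * (1 / t : ℝ) ^ W ≤ (1 + 4 ^ W + 8 ^ (k + 1)) * (1 / t : ℝ) ^ W := by
  have ht' : (2 : ℝ) ≤ t := by exact_mod_cast ht
  have ht0 : (0 : ℝ) < t := by linarith
  have h1 : (1 - 1 / (t ^ 5 : ℕ) : ℝ) ^ (t ^ 6) ≤ (1 / t : ℝ) ^ W := by
    have h5 : (0 : ℝ) ≤ 1 - 1 / (t ^ 5 : ℕ) := by
      rw [sub_nonneg, div_le_one (by positivity)]
      exact_mod_cast Nat.one_le_pow _ _ (by omega)
    calc (1 - 1 / (t ^ 5 : ℕ) : ℝ) ^ (t ^ 6) ≤ Real.exp (-(1 / (t ^ 5 : ℕ))) ^ (t ^ 6) := by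
          gcongr
          exact Real.one_sub_le_exp_neg _
      _ = Real.exp (-t) := by
          rw [← Real.exp_nat_mul]
          congr 1
          push_cast
          field_simp
      _ ≤ (1 / t : ℝ) ^ W := by
          rw [one_div, inv_pow, ← one_div, le_div_iff₀ (by positivity), mul_comm]
          exact hexp
  have h2 : ((3 * (t ^ 6 : ℕ) + 1) / (t ^ 14 : ℕ) : ℝ) ^ W ≤ 4 ^ W * (1 / t : ℝ) ^ W := by
    rw [← mul_pow]
    gcongr
    rw [mul_one_div, div_le_div_iff₀ (by positivity) ht0]
    push_cast
    have h6 : (1 : ℝ) ≤ t ^ 6 := one_le_pow₀ (by linarith)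
    have h7 : (1 : ℝ) ≤ t ^ 7 := one_le_pow₀ (by linarith)
    have h14 : (t : ℝ) ^ 14 = t ^ 7 * t ^ 7 := by ring
    rw [h14]
    have : (t : ℝ) ^ 7 = t ^ 6 * t := by ring
    nlinarith
  linarith

open Filter Topology in
/-- The constants and the gap between `n` and a perfect twentieth power are absorbed for large `t`,
as the integer `⌊√(100 k)⌋ + 1` exceeds `√(100 k)`. -/
theorem eventually_parameters (k : ℕ) : ∀ᶠ t : ℕ in atTop,
    2 ≤ t ∧ 2 * (Nat.sqrt (100 * k) + 1) + 2 ≤ t ∧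
    (t : ℝ) ^ (Nat.sqrt (100 * k) + 1) * Real.exp (-t) ≤ 1 ∧
    ((t + 1 : ℕ) : ℝ) ^ Real.sqrt (100 * k) *
      (1 + 4 ^ (Nat.sqrt (100 * k) + 1) + 8 ^ (k + 1)) < (t : ℝ) ^ (Nat.sqrt (100 * k) + 1) := by
  set W := Nat.sqrt (100 * k) + 1 with hW
  set a := Real.sqrt (100 * k) with ha
  set c : ℝ := 1 + 4 ^ W + 8 ^ (k + 1) with hc
  have hc0 : 0 < c := by positivity
  have ha0 : 0 ≤ a := Real.sqrt_nonneg _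
  have haW : a < W := by
    rw [ha, Real.sqrt_lt' (by positivity)]
    have := Nat.lt_succ_sqrt (100 * k)
    rw [pow_two]
    exact_mod_cast this
  have hcast : Tendsto (fun t : ℕ => (t : ℝ)) atTop atTop := tendsto_natCast_atTop_atTop
  have h1 : ∀ᶠ t : ℕ in atTop, (t : ℝ) ^ W * Real.exp (-t) < 1 :=
    ((Real.tendsto_pow_mul_exp_neg_atTop_nhds_zero W).comp hcast).eventually_lt_const one_pos
  have h2 : ∀ᶠ t : ℕ in atTop, 2 ^ a * c < (t : ℝ) ^ ((W : ℝ) - a) :=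
    ((tendsto_rpow_atTop (sub_pos.2 haW)).comp hcast).eventually_gt_atTop _
  filter_upwards [h1, h2, eventually_ge_atTop 2, eventually_ge_atTop (2 * W + 2)]
    with t h1 h2 h3 h4
  refine ⟨h3, h4, h1.le, ?_⟩
  have ht : (2 : ℝ) ≤ t := by exact_mod_cast h3
  have ht0 : (0 : ℝ) < t := by linarith
  calc ((t + 1 : ℕ) : ℝ) ^ a * c ≤ (2 * t) ^ a * c := by
        gcongr
        push_cast
        linarith
    _ = 2 ^ a * c * t ^ a := by rw [Real.mul_rpow two_pos.le ht0.le]; ring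
    _ < t ^ ((W : ℝ) - a) * t ^ a := by gcongr
    _ = t ^ W := by rw [← Real.rpow_add ht0, sub_add_cancel, Real.rpow_natCast]

/-- For every `k` and all sufficiently large `n`, every p-Res(1) refutation of `(RLNP_n, k)` has
size at least `n ^ √(k / 4)`. -/
theorem mainTheorem1 (k : ℕ) :
    ∃ N : ℕ, ∀ n : ℕ, N ≤ n → ∀ ρ : PResRefutation (RLNP n) k,
      (n : ℝ) ^ Real.sqrt ((k : ℝ) / 4) ≤ (ρ.size : ℝ) := by
  rcases Nat.eq_zero_or_pos k with rfl | hk0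
  · refine ⟨0, fun n _ ρ => ?_⟩
    obtain ⟨i, -⟩ := ρ.refutes
    have : 1 ≤ ρ.size := Nat.one_le_iff_ne_zero.2 fun h => by
      have := i.isLt
      omega
    simpa using this
  rcases Nat.lt_or_ge k 5 with hk | hk
  · refine ⟨1, fun n hn ρ => ?_⟩
    have h1 : Real.sqrt ((k : ℝ) / 4) ≤ 1 := by
      rw [Real.sqrt_le_one]
      have : (k : ℝ) ≤ 4 := by exact_mod_cast Nat.le_of_lt_succ hk
      linarith
    calc (n : ℝ) ^ Real.sqrt ((k : ℝ) / 4) ≤ (n : ℝ) ^ (1 : ℝ) :=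
          Real.rpow_le_rpow_of_exponent_le (by exact_mod_cast hn) h1
      _ = n := Real.rpow_one _
      _ ≤ ρ.size := by exact_mod_cast (lt_size_of_pos hk0 ρ).le
  · obtain ⟨t₀, ht₀⟩ := Filter.eventually_atTop.1 (eventually_parameters k)
    refine ⟨(t₀ + 1) ^ 20 + 1, fun n hn ρ => ?_⟩
    have hex : ∃ t, n ≤ (t + 1) ^ 20 :=
      ⟨n, (Nat.le_succ n).trans (Nat.le_self_pow (by norm_num) _)⟩
    obtain ⟨t, htn, htn'⟩ : ∃ t, t ^ 20 < n ∧ n ≤ (t + 1) ^ 20 := by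
      classical
      refine ⟨Nat.find hex, ?_, Nat.find_spec hex⟩
      rcases Nat.eq_zero_or_pos (Nat.find hex) with h0 | h0
      · rw [h0]
        have : 0 < (t₀ + 1) ^ 20 := by positivity
        omega
      · have := Nat.find_min hex (Nat.sub_one_lt_of_lt h0)
        rw [show Nat.find hex - 1 + 1 = Nat.find hex from Nat.sub_add_cancel h0] at this
        omega
    have htt : t₀ ≤ t := by
      by_contra! h
      have : (t + 1) ^ 20 ≤ (t₀ + 1) ^ 20 := Nat.pow_le_pow_left (by omega) 20
      omega
    obtain ⟨h1, h2, h3, h4⟩ := ht₀ t htt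
    have hone := one_le_size_mul hk ρ h1 htn h2
    generalize Nat.sqrt (100 * k) + 1 = W at h3 h4 hone
    have ht0 : (0 : ℝ) < t := by exact_mod_cast (by omega : 0 < t)
    have hsize : (t : ℝ) ^ W ≤ ρ.size * (1 + 4 ^ W + 8 ^ (k + 1)) := by
      have h := hone.trans (mul_le_mul_of_nonneg_left (bad_probability_le h1 W k h3)
        (Nat.cast_nonneg _))
      have hpow : (1 / t : ℝ) ^ W * (t : ℝ) ^ W = 1 := by
        rw [← mul_pow, one_div_mul_cancel ht0.ne', one_pow]
      calc (t : ℝ) ^ W = 1 * (t : ℝ) ^ W := (one_mul _).symm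
        _ ≤ ρ.size * ((1 + 4 ^ W + 8 ^ (k + 1)) * (1 / t : ℝ) ^ W) * (t : ℝ) ^ W :=
            mul_le_mul_of_nonneg_right h (pow_nonneg ht0.le W)
        _ = ρ.size * (1 + 4 ^ W + 8 ^ (k + 1)) := by
            rw [← mul_assoc, mul_assoc, hpow, mul_one]
    have hlt : ((t + 1 : ℕ) : ℝ) ^ Real.sqrt (100 * k) < ρ.size :=
      lt_of_mul_lt_mul_right (h4.trans_le hsize)
        (add_nonneg (add_nonneg zero_le_one (pow_nonneg zero_le_four W))
          (pow_nonneg (by norm_num) (k + 1)))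
    have hexp : Real.sqrt (100 * k) = 20 * Real.sqrt ((k : ℝ) / 4) := by
      rw [show (100 * k : ℝ) = 20 ^ 2 * (k / 4) by ring, Real.sqrt_mul (by norm_num),
        Real.sqrt_sq (by norm_num)]
    calc (n : ℝ) ^ Real.sqrt ((k : ℝ) / 4)
        ≤ (((t + 1) ^ 20 : ℕ) : ℝ) ^ Real.sqrt ((k : ℝ) / 4) :=
          Real.rpow_le_rpow (Nat.cast_nonneg _) (Nat.cast_le.2 htn') (Real.sqrt_nonneg _)
      _ = ((t + 1 : ℕ) : ℝ) ^ Real.sqrt (100 * k) := by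
          rw [hexp, Real.rpow_mul (Nat.cast_nonneg _), Nat.cast_pow]
          exact congrArg (· ^ Real.sqrt ((k : ℝ) / 4)) (Real.rpow_ofNat _ 20).symm
      _ ≤ ρ.size := hlt.le
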